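/- Let $A$ be a Noetherian commutative ring, separated and complete for the $I$-adic topology of an ideal $I$. Let $A\langle X_1,\dots,X_m\rangle$ be the ring of power series over $A$ whose coefficients tend $I$-adically to $0$, put $\mathcal A_{m,n}=A\langle X_1,\dots,X_m\rangle[[Y_1,\dots,Y_n]]$, and let $t\mapsto t^\sigma$ be an automorphism of the inductive system of rings $(\mathcal A_{m,n})_{m,n}$ (with the inclusions as transition maps). An *analytic field with an automorphism* $M$ consists of a field $K$ of characteristic $0$, a valuation ring $\mathcal O$ of $K$ with valuation $\mathrm{val}$, value group $\Gamma$ and residue field $k=\mathcal O/\mathfrak m$, a valuation ring $\mathcal R\subseteq\mathcal O$ of $K$ with maximal ideal $\mathfrak M$, ring morphisms $i_{m,n}:\mathcal A_{m,n}\to\mathcal R^{\mathcal R^m\times\mathfrak M^n}$, compatible with the inclusions, that send the variables to the corresponding coordinate functions and satisfy $i_{0,0}(I)\subseteq\mathfrak M$, and a field automorphism $\sigma$ of $K$ with $\sigma(\mathcal O)=\mathcal O$ and $\sigma(\mathcal R)=\mathcal R$ such that $\sigma(f(x))=f^\sigma(\sigma(x))$ for all $f\in\mathcal A_{m,n}$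 and $x\in K^{m+n}$. Here $f$ also denotes the function $K^{m+n}\to K$ that equals $i_{m,n}(f)$ on $\mathcal R^m\times\mathfrak M^n$ and $0$ elsewhere. We also write $\sigma$ for the automorphisms induced on $\Gamma$ and on $k$. By a *term* we mean a term in variables $x_0,\dots,x_n$ (for some $n\ge 0$) built from elements of $K$, the ring operations, the functions $f\in\mathcal A_{m,n}$, and $Q(x,y)=x/y$ (with $Q(x,0)=0$). A term is zero if it defines the zero function. Put $\bar\sigma(x)=(x,\sigma(x),\dots,\sigma^n(x))$. * A sequence $(x_\alpha)_{\alpha<\beta}$ of distinct points of $K$ is *pseudo-convergent* if $\mathrm{val}(x_\alpha-x_\delta)<\mathrm{val}(x_\gamma-x_\delta)$ for all $\alpha<\gamma<\delta<\beta$. A point $a$ is a *pseudo-limit* of it if $\mathrm{val}(x_\alpha-a)<\mathrm{val}(x_\gamma-a)$ for all $\alpha<\gamma<\beta$. The sequence *$\sigma$-pseudo-solves* a term $t$ if $t=0$ or if, on some final segment, $t(\bar\sigma(x_\alpha))$ is pseudo-convergent with pseudo-limit $0$. $M$ is *$\sigma$-algebraically maximally complete* if every pseudo-convergent sequence in $K$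 that is indexed by a limit ordinal and $\sigma$-pseudo-solves some term $t\ne 0$ has a pseudo-limit in $K$. * The difference field $(k,\sigma)$ is *linearly closed* if every equation $\sum_{i=0}^n a_i\sigma^i(x)=b$ with $a_i,b\in k$ and $a_n\ne0$ has a solution in $k$. * For a term $t$ in $x_0,\dots,x_n$, $a\in K$, $d=(d_0,\dots,d_n)\in K^{n+1}$ and $\xi\in\Gamma$, we say that $(t,a,d,\xi)$ is in *$\sigma$-Hensel configuration* if $\mathrm{val}(t(\bar\sigma(a)))>\min_i\{\mathrm{val}(d_i)+\sigma^i(\xi)\}$ and $d$ linearly approximates $t$ at prolongations on the open ball $b=\{x:\mathrm{val}(x-a)>\xi\}$. The latter means that $$\mathrm{val}\Bigl(t(\bar\sigma(c))-t(\bar\sigma(e))-\sum_i d_i\sigma^i(c-e)\Bigr)>\min_i\{\mathrm{val}(d_i)+\mathrm{val}(\sigma^i(c-e))\}$$ for all $c\neq e$ in $b$, or else that $d=0$ and $t(\bar\sigma(x))$ is constant on $b$. * $M$ is *$\sigma$-Henselian* if for every $(t,a,d,\xi)$ in $\sigma$-Hensel configuration there is $c\in K$ with $t(\bar\sigma(c))=0$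 and $\mathrm{val}(c-a)\ge\max_{i:\,d_i\ne0}\mathrm{val}\bigl(\sigma^{-i}(t(\bar\sigma(a))\,d_i^{-1})\bigr)$. **Proposition.** Let $M$ be an analytic field with an automorphism. If $M$ is $\sigma$-algebraically maximally complete and its residue field $(k,\sigma)$ is linearly closed, then $M$ is $\sigma$-Henselian. -/

import Mathlib

universe u v

noncomputable section

namespace AnalyticDifference

/-! ### Separated power series over an adic ring -/

section Series

variable {A : Type u} [CommRing A]

/-- The ring `A⟨X₀, …, X_{m-1}⟩` of power series over `A` whose coefficients converge to `0`
in the `I`-adic topology. -/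
def RestrictedSeries (I : Ideal A) (m : ℕ) : Subring (MvPowerSeries (Fin m) A) where
  carrier := {f | ∀ k : ℕ, {μ : Fin m →₀ ℕ | MvPowerSeries.coeff μ f ∉ I ^ k}.Finite}
  mul_mem' := by
    classical
    intro f g hf hg k
    refine ((hf k).add (hg k)).subset ?_
    intro μ hμ
    by_contra hcon
    apply hμ
    rw [MvPowerSeries.coeff_mul]
    refine Ideal.sum_mem _ ?_
    rintro ⟨a, b⟩ hab
    by_cases ha : MvPowerSeries.coeff a f ∈ I ^ k
    · exact Ideal.mul_mem_right _ _ ha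
    · by_cases hb : MvPowerSeries.coeff b g ∈ I ^ k
      · exact Ideal.mul_mem_left _ _ hb
      · exact absurd (Set.mem_add.2 ⟨a, ha, b, hb, Finset.HasAntidiagonal.mem_antidiagonal.1 hab⟩) hcon
  one_mem' := by
    classical
    intro k
    refine (Set.finite_singleton (0 : Fin m →₀ ℕ)).subset ?_
    intro μ hμ
    by_contra hne
    apply hμ
    rw [MvPowerSeries.coeff_one, if_neg (by simpa using hne)]
    exact Ideal.zero_mem _
  add_mem' := by
    intro f g hf hg k
    refine ((hf k).union (hg k)).subset ?_
    intro μ hμ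
    by_contra hcon
    simp only [Set.mem_union, Set.mem_ofPred_eq, not_or, not_not] at hcon
    apply hμ
    rw [map_add]
    exact Ideal.add_mem _ hcon.1 hcon.2
  zero_mem' := by
    intro k
    simp
  neg_mem' := by
    intro f hf k
    simpa using hf k

theorem X_mem_restrictedSeries (I : Ideal A) {m : ℕ} (i : Fin m) :
    (MvPowerSeries.X i : MvPowerSeries (Fin m) A) ∈ RestrictedSeries I m := by
  classical
  intro k
  refine (Set.finite_singleton (Finsupp.single i 1)).subset ?_
  intro μ hμ
  by_contra hne
  apply hμ
  rw [MvPowerSeries.coeff_X, if_neg (by simpa using hne)]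
  exact Ideal.zero_mem _

theorem rename_mem_restrictedSeries (I : Ideal A) {m m' : ℕ} (h : m ≤ m')
    {f : MvPowerSeries (Fin m) A} (hf : f ∈ RestrictedSeries I m) :
    MvPowerSeries.rename (Fin.castLE h) f ∈ RestrictedSeries I m' := by
  intro k
  refine ((hf k).image (Finsupp.mapDomain (Fin.castLE h))).subset ?_
  intro μ hμ
  by_contra hcon
  apply hμ
  rw [MvPowerSeries.coeff_rename]
  refine Ideal.sum_mem _ ?_
  intro ν hν
  by_contra hν'
  exact hcon ⟨ν, hν', by simpa using hν⟩

/-- The inclusion `A⟨X₀, …, X_{m-1}⟩ ⊆ A⟨X₀, …, X_{m'-1}⟩` for `m ≤ m'`. -/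
def RestrictedSeries.incl (I : Ideal A) {m m' : ℕ} (h : m ≤ m') :
    RestrictedSeries I m →+* RestrictedSeries I m' :=
  (((MvPowerSeries.rename (R := A) (Fin.castLE h)).toRingHom.comp
    (RestrictedSeries I m).subtype)).codRestrict (RestrictedSeries I m')
    (fun f => rename_mem_restrictedSeries I h f.2)

/-- The ring `𝒜_{m,n} = A⟨X₀, …, X_{m-1}⟩[[Y₀, …, Y_{n-1}]]` of separated power series. -/
abbrev SepSeries (I : Ideal A) (m n : ℕ) : Type u :=
  MvPowerSeries (Fin n) (RestrictedSeries I m)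

/-- The inclusion `𝒜_{m,n} ⊆ 𝒜_{m',n'}` for `m ≤ m'` and `n ≤ n'`; these are the transition maps
of the inductive system of the rings `𝒜_{m,n}`. -/
def SepSeries.incl (I : Ideal A) {m m' n n' : ℕ} (hm : m ≤ m') (hn : n ≤ n') :
    SepSeries I m n →+* SepSeries I m' n' :=
  (MvPowerSeries.rename (R := RestrictedSeries I m') (Fin.castLE hn)).toRingHom.comp
    (MvPowerSeries.map (RestrictedSeries.incl I hm))

/-- The variable `X_i` in `𝒜_{m,n}`. -/
def SepSeries.varX (I : Ideal A) {m : ℕ} (n : ℕ) (i : Fin m) : SepSeries I m n :=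
  MvPowerSeries.C (σ := Fin n)
    (⟨MvPowerSeries.X i, X_mem_restrictedSeries I i⟩ : RestrictedSeries I m)

/-- The variable `Y_j` in `𝒜_{m,n}`. -/
def SepSeries.varY (I : Ideal A) (m : ℕ) {n : ℕ} (j : Fin n) : SepSeries I m n :=
  MvPowerSeries.X j

theorem C_mem_restrictedSeries (I : Ideal A) (m : ℕ) (a : A) :
    (MvPowerSeries.C a : MvPowerSeries (Fin m) A) ∈ RestrictedSeries I m := by
  classical
  intro k
  refine (Set.finite_singleton (0 : Fin m →₀ ℕ)).subset ?_
  intro μ hμ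
  by_contra hne
  apply hμ
  rw [MvPowerSeries.coeff_C, if_neg (by simpa using hne)]
  exact Ideal.zero_mem _

/-- An element of `A`, viewed as an element of `𝒜_{0,0} = A`. -/
def SepSeries.const (I : Ideal A) (a : A) : SepSeries I 0 0 :=
  MvPowerSeries.C (σ := Fin 0)
    (⟨MvPowerSeries.C a, C_mem_restrictedSeries I 0 a⟩ : RestrictedSeries I 0)

/-- An automorphism `t ↦ t^σ` of the inductive system of rings `(𝒜_{m,n})`. -/
structure SystemAut (I : Ideal A) where
  /-- The automorphism of `𝒜_{m,n}`. -/
  toEquiv : ∀ m n : ℕ, SepSeries I m n ≃+* SepSeries I m n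
  /-- It commutes with the transition maps. -/
  incl_comm : ∀ {m m' n n' : ℕ} (hm : m ≤ m') (hn : n ≤ n') (f : SepSeries I m n),
    toEquiv m' n' (SepSeries.incl I hm hn f) = SepSeries.incl I hm hn (toEquiv m n f)

end Series

/-! ### Fields with separated analytic structure and an automorphism -/

/-- A field with separated analytic `𝒜`-structure: a field with a valuation ring `𝒪`, a valuation
ring `ℛ ⊆ 𝒪` of the same field, and interpretations of the elements of `𝒜_{m,n}` as functions
`ℛ^m × 𝔐^n → ℛ`, where `𝔐` is the maximal ideal of `ℛ`. The leading term sorts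
`K^× / (1 + k 𝔪) ∪ {0}` and their structure are determined by these data. -/
structure AnalyticField {A : Type u} [CommRing A] (I : Ideal A) (K : Type v) [Field K] where
  /-- The valuation ring `𝒪` of the valued field. -/
  valRing : ValuationSubring K
  /-- The smaller valuation ring `ℛ` that carries the analytic structure. -/
  anRing : ValuationSubring K
  /-- `ℛ ⊆ 𝒪`. -/
  anRing_le : anRing ≤ valRing
  /-- The ring morphisms from `𝒜_{m,n}` to the functions `ℛ^m × 𝔐^n → ℛ`. -/
  interp : ∀ m n : ℕ, SepSeries I m n →+*
    ((Fin m → anRing) × (Fin n → IsLocalRing.maximalIdeal anRing) → anRing)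
  /-- They form a morphism of inductive systems: functions of fewer variables are viewed as
  functions of more variables by ignoring the additional ones. -/
  interp_incl : ∀ {m m' n n' : ℕ} (hm : m ≤ m') (hn : n ≤ n') (f : SepSeries I m n)
    (x : Fin m' → anRing) (y : Fin n' → IsLocalRing.maximalIdeal anRing),
    interp m' n' (SepSeries.incl I hm hn f) (x, y) =
      interp m n f (fun i => x (Fin.castLE hm i), fun j => y (Fin.castLE hn j))
  /-- The constants from `I` are interpreted in `𝔐`. -/
  interp_const : ∀ a ∈ I, ∀ p,
    interp 0 0 (SepSeries.const I a) p ∈ IsLocalRing.maximalIdeal anRing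
  /-- `X_i` is interpreted as a coordinate function. -/
  interp_varX : ∀ (m n : ℕ) (i : Fin m) (x : Fin m → anRing)
    (y : Fin n → IsLocalRing.maximalIdeal anRing),
    interp m n (SepSeries.varX I n i) (x, y) = x i
  /-- `Y_j` is interpreted as a coordinate function. -/
  interp_varY : ∀ (m n : ℕ) (j : Fin n) (x : Fin m → anRing)
    (y : Fin n → IsLocalRing.maximalIdeal anRing),
    interp m n (SepSeries.varY I m j) (x, y) = (y j : anRing)

namespace AnalyticField

variable {A : Type u} [CommRing A] {I : Ideal A} {K : Type v} [Field K]

open Classical in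
/-- The function `K^{m+n} → K` named by the symbol `f ∈ 𝒜_{m,n}`: the interpretation of `f` on
`ℛ^m × 𝔐^n`, and `0` elsewhere. -/
def symb (M : AnalyticField I K) {m n : ℕ} (f : SepSeries I m n) (x : Fin (m + n) → K) : K :=
  if h : (∀ i : Fin m, x (Fin.castAdd n i) ∈ M.anRing) ∧
      (∀ j : Fin n, ∃ hj : x (Fin.natAdd m j) ∈ M.anRing,
        (⟨x (Fin.natAdd m j), hj⟩ : M.anRing) ∈ IsLocalRing.maximalIdeal M.anRing) then
    ((M.interp m n f (fun i => ⟨x (Fin.castAdd n i), h.1 i⟩,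
      fun j => ⟨⟨x (Fin.natAdd m j), (h.2 j).1⟩, (h.2 j).2⟩) : M.anRing) : K)
  else 0

/-- The additively written value group of `𝒪`, with `∞` adjoined as largest element. -/
abbrev Val (M : AnalyticField I K) : Type v := (Additive M.valRing.ValueGroup)ᵒᵈ

/-- The additively written valuation of `𝒪`, onto the value group with `∞`. -/
def val (M : AnalyticField I K) : AddValuation K M.Val := M.valRing.valuation.toAddValuation

theorem val_surjective (M : AnalyticField I K) : Function.Surjective M.val :=
  M.valRing.valuation_surjective

/-- The open ball of radius `ξ` around `a`. -/
def openBall (M : AnalyticField I K) (ξ : M.Val) (a : K) : Set K := {x | ξ < M.val (x - a)}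

end AnalyticField

/-- The function symbols on the field sort: the ring symbols, the quotient symbol `Q`, and a
symbol for each element of each `𝒜_{m,n}`. -/
inductive FieldFunctions {A : Type u} [CommRing A] (I : Ideal A) : ℕ → Type u
  | zero : FieldFunctions I 0
  | one : FieldFunctions I 0
  | neg : FieldFunctions I 1
  | add : FieldFunctions I 2
  | mul : FieldFunctions I 2
  | quot : FieldFunctions I 2
  | analytic {m n : ℕ} (f : SepSeries I m n) : FieldFunctions I (m + n)

/-- The restriction to the field sort of the language of analytic fields with quotients. -/
def fieldLanguage {A : Type u} [CommRing A] (I : Ideal A) : FirstOrder.Language.{u, 0} where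
  Functions := FieldFunctions I
  Relations := fun _ => Empty

namespace AnalyticField

variable {A : Type u} [CommRing A] {I : Ideal A} {K : Type v} [Field K]

/-- The interpretation of the function symbols; in Lean `x / 0 = 0`, as it must be for `Q`. -/
def funInterp (M : AnalyticField I K) : ∀ {k : ℕ}, FieldFunctions I k → (Fin k → K) → K
  | _, .zero, _ => 0
  | _, .one, _ => 1
  | _, .neg, x => - x 0
  | _, .add, x => x 0 + x 1
  | _, .mul, x => x 0 * x 1
  | _, .quot, x => x 0 / x 1
  | _, .analytic f, x => M.symb f x

/-- The field sort as a first-order structure. -/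
@[reducible] def fieldStructure (M : AnalyticField I K) : (fieldLanguage I).Structure K where
  funMap := fun f x => M.funInterp f x
  RelMap := fun r _ => r.elim

/-- Terms of the field sort with parameters from `K`, in the variables `x₀, …, xₙ`. -/
abbrev KTerm (_M : AnalyticField I K) (n : ℕ) : Type (max u v) :=
  (fieldLanguage I).Term (K ⊕ Fin (n + 1))

/-- The value of a term at a tuple. -/
def eval (M : AnalyticField I K) {n : ℕ} (t : M.KTerm n) (x : Fin (n + 1) → K) : K :=
  letI := M.fieldStructure
  t.realize (Sum.elim id x)

end AnalyticField

/-- An analytic field with an automorphism. A field automorphism induces an automorphism of the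
leading term structure exactly when it preserves `𝒪`. -/
structure AnalyticDifferenceField {A : Type u} [CommRing A] (I : Ideal A) (τ : SystemAut I)
    (K : Type v) [Field K] extends AnalyticField I K where
  /-- The automorphism `σ` of the field. -/
  sigma : K ≃+* K
  /-- `σ` preserves `𝒪`. -/
  sigma_mem_valRing : ∀ x : K, sigma x ∈ valRing ↔ x ∈ valRing
  /-- `σ` preserves `ℛ`. -/
  sigma_mem_anRing : ∀ x : K, sigma x ∈ anRing ↔ x ∈ anRing
  /-- `σ(f(x)) = f^σ(σ(x))` for each symbol `f`. -/
  sigma_symb : ∀ {m n : ℕ} (f : SepSeries I m n) (x : Fin (m + n) → K),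
    sigma (toAnalyticField.symb f x) =
      toAnalyticField.symb (τ.toEquiv m n f) (fun i => sigma (x i))

/-- A difference field `(k, s)` is linearly closed if every equation
`a₀ x + a₁ s(x) + ⋯ + aₙ sⁿ(x) = b` with `aₙ ≠ 0` has a solution. -/
def LinearlyClosed (k : Type v) [Field k] (s : k ≃+* k) : Prop :=
  ∀ (n : ℕ) (a : Fin (n + 1) → k) (b : k), a (Fin.last n) ≠ 0 →
    ∃ x : k, ∑ i : Fin (n + 1), a i * s^[(i : ℕ)] x = b

namespace AnalyticDifferenceField

variable {A : Type u} [CommRing A] {I : Ideal A} {τ : SystemAut I} {K : Type v} [Field K]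

/-- The automorphism of the valuation ring `𝒪` induced by `σ`. -/
def sigmaValRing (M : AnalyticDifferenceField I τ K) : M.valRing ≃+* M.valRing where
  toFun x := ⟨M.sigma x, (M.sigma_mem_valRing x).2 x.2⟩
  invFun x := ⟨M.sigma.symm x, (M.sigma_mem_valRing _).1 (by simp)⟩
  left_inv x := by ext; simp
  right_inv x := by ext; simp
  map_mul' x y := by ext; simp
  map_add' x y := by ext; simp

/-- The residue field of `𝒪` with the automorphism induced by `σ` is linearly closed. -/
def ResidueLinearlyClosed (M : AnalyticDifferenceField I τ K) : Prop :=
  LinearlyClosed (IsLocalRing.ResidueField M.valRing)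
    (IsLocalRing.ResidueField.mapEquiv M.sigmaValRing)

/-- The map induced by `σ` on the value group with `∞`; see `sigmaVal_val`. -/
def sigmaVal (M : AnalyticDifferenceField I τ K) (γ : M.Val) : M.Val :=
  M.val (M.sigma (Function.surjInv M.val_surjective γ))

theorem val_le_val_iff (M : AnalyticDifferenceField I τ K) (x y : K) :
    M.val x ≤ M.val y ↔ ∃ a : M.valRing, (a : K) * x = y := by
  have h : M.val x ≤ M.val y ↔ M.valRing.valuation y ≤ M.valRing.valuation x := Iff.rfl
  rw [h]
  exact Iff.rfl

theorem val_sigma_le (M : AnalyticDifferenceField I τ K) {x y : K} (h : M.val x ≤ M.val y) :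
    M.val (M.sigma x) ≤ M.val (M.sigma y) := by
  obtain ⟨a, ha⟩ := (M.val_le_val_iff x y).1 h
  refine (M.val_le_val_iff _ _).2 ⟨M.sigmaValRing a, ?_⟩
  rw [← ha, map_mul]
  rfl

theorem sigmaVal_val (M : AnalyticDifferenceField I τ K) (x : K) :
    M.sigmaVal (M.val x) = M.val (M.sigma x) := by
  have h := Function.surjInv_eq M.val_surjective (M.val x)
  exact le_antisymm (M.val_sigma_le h.le) (M.val_sigma_le h.ge)

/-- The prolongation `(x, σ(x), …, σⁿ(x))`. -/
def prol (M : AnalyticDifferenceField I τ K) (n : ℕ) (x : K) : Fin (n + 1) → K :=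
  fun i => M.sigma^[(i : ℕ)] x

/-- The tuple `d` linearly approximates `f` at prolongations on the set `b`. By convention a
function that is constant on `b` is linearly approximated by the zero tuple. -/
def LinearApproxAtProl (M : AnalyticDifferenceField I τ K) {n : ℕ}
    (f : (Fin (n + 1) → K) → K) (d : Fin (n + 1) → K) (b : Set K) : Prop :=
  (∀ a ∈ b, ∀ c ∈ b, a ≠ c →
    (Finset.univ.inf fun i : Fin (n + 1) => M.val (d i) + M.val (M.sigma^[(i : ℕ)] (c - a))) <
      M.val (f (M.prol n c) - f (M.prol n a) - ∑ i : Fin (n + 1), d i * M.prol n (c - a) i)) ∨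
  (d = 0 ∧ ∀ a ∈ b, ∀ c ∈ b, f (M.prol n a) = f (M.prol n c))

/-- `(t, a, d, ξ)` is in `σ`-Hensel configuration; here `ξ` lies in the value group. -/
structure HenselConfig (M : AnalyticDifferenceField I τ K) {n : ℕ} (t : M.KTerm n) (a : K)
    (d : Fin (n + 1) → K) (ξ : M.Val) : Prop where
  ne_top : ξ ≠ ⊤
  approx : M.LinearApproxAtProl (M.eval t) d (M.openBall ξ a)
  lt_val : (Finset.univ.inf fun i : Fin (n + 1) => M.val (d i) + M.sigmaVal^[(i : ℕ)] ξ) <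
    M.val (M.eval t (M.prol n a))

/-- `σ`-Henselianity. As `-∞` is the valuation of the inverse of `0`, the maximum of the values
`val (σ^{-i}(t(a, σ(a), …) dᵢ⁻¹))` is taken over the indices `i` with `dᵢ ≠ 0`. -/
def SigmaHenselian (M : AnalyticDifferenceField I τ K) : Prop :=
  ∀ (n : ℕ) (t : M.KTerm n) (a : K) (d : Fin (n + 1) → K) (ξ : M.Val),
    M.HenselConfig t a d ξ →
      ∃ c : K, M.eval t (M.prol n c) = 0 ∧
        ∀ i : Fin (n + 1), d i ≠ 0 →
          M.val (M.sigma.symm^[(i : ℕ)] (M.eval t (M.prol n a) * (d i)⁻¹)) ≤ M.val (c - a)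

/-- The family `x` restricted to the set `S` of ordinals is a pseudo-convergent sequence of
distinct points. -/
def PseudoConvergent (M : AnalyticDifferenceField I τ K) (S : Set Ordinal.{v})
    (x : Ordinal.{v} → K) : Prop :=
  Set.InjOn x S ∧ ∀ α ∈ S, ∀ γ ∈ S, ∀ δ ∈ S, α < γ → γ < δ →
    M.val (x α - x δ) < M.val (x γ - x δ)

/-- The point `a` is a pseudo-limit of the family `x` restricted to the set `S` of ordinals. -/
def IsPseudoLimit (M : AnalyticDifferenceField I τ K) (S : Set Ordinal.{v})
    (x : Ordinal.{v} → K) (a : K) : Prop :=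
  ∀ α ∈ S, ∀ γ ∈ S, α < γ → M.val (x α - a) < M.val (x γ - a)

/-- The term `t` is zero, as a function on tuples. -/
def TermIsZero (M : AnalyticDifferenceField I τ K) {n : ℕ} (t : M.KTerm n) : Prop :=
  ∀ p : Fin (n + 1) → K, M.eval t p = 0

/-- The sequence `(x_α)_{α < β}` `σ`-pseudo-solves `t`: either `t = 0`, or on some final segment
the values `t(x_α, σ(x_α), …)` are pseudo-convergent with pseudo-limit `0`. -/
def SigmaPseudoSolves (M : AnalyticDifferenceField I τ K) (β : Ordinal.{v})
    (x : Ordinal.{v} → K) {n : ℕ} (t : M.KTerm n) : Prop :=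
  M.TermIsZero t ∨ ∃ α₀ < β,
    M.PseudoConvergent (Set.Ico α₀ β) (fun α => M.eval t (M.prol n (x α))) ∧
    M.IsPseudoLimit (Set.Ico α₀ β) (fun α => M.eval t (M.prol n (x α))) 0

/-- `σ`-algebraic maximal completeness: each pseudo-convergent sequence indexed by a limit ordinal
that `σ`-pseudo-solves a non-zero term has a pseudo-limit. -/
def SigmaAlgMaxComplete (M : AnalyticDifferenceField I τ K) : Prop :=
  ∀ (β : Ordinal.{v}) (x : Ordinal.{v} → K), Order.IsSuccLimit β →
    M.PseudoConvergent (Set.Iio β) x →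
    (∃ (n : ℕ) (t : M.KTerm n), ¬ M.TermIsZero t ∧ M.SigmaPseudoSolves β x t) →
    ∃ a : K, M.IsPseudoLimit (Set.Iio β) x a

end AnalyticDifferenceField

end AnalyticDifference

end

/-! This is a transfinite Newton approximation. Write `f` for `t` at prolongations and say that `y`
improves `x` if `val (f y) > val (f x)` and each monomial `d i * σ ^ i` has value at least `val (f
x)` at `y - x`. This relation is transitive, and improvements of the centre stay in the ball by the
inequality in the Hensel configuration.

At a point where `f` does not vanish, rescaling turns the linearised equation into a nontrivial
linear difference equation over the residue field. A lift of a solution gives an improvement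
(`exists_improves`). Along a sequence of improvements the points are pseudo-convergent
(`val_sub_lt`), and the values of `f` have strictly increasing valuations, so the sequence
`σ`-pseudo-solves `t`. Maximal completeness supplies a pseudo-limit, which improves every member
(`exists_improves_of_sequence`).

A Zorn argument (`exists_maximal_of_sequences_bounded`) then yields a point without improvement,
which must be a zero. Its distance from the centre is bounded through the monomials. -/

/-! ### Cofinal sequences in linear orders -/

/-- Needed because completeness speaks of sequences indexed by ordinals, whereas Zorn's lemma
produces chains. -/
theorem exists_strictMonoOn_cofinal_of_noMaxOrder (α : Type v) [LinearOrder α] [Nonempty α]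
    [NoMaxOrder α] :
    ∃ (β : Ordinal.{v}) (x : Ordinal.{v} → α), Order.IsSuccLimit β ∧
      StrictMonoOn x (Set.Iio β) ∧ ∀ a, ∃ γ < β, a < x γ := by
  classical
  -- The records: elements exceeding all their predecessors in a well-ordering of `α`. On `S` the
  -- given order agrees with the well-ordering, so `S` is well-ordered and still cofinal.
  let S : Set α := {a | ∀ b, WellOrderingRel b a → b < a}
  have hS : IsCofinal S := isCofinal_setOfPred_imp_lt WellOrderingRel
  have hlt : ∀ a ∈ S, ∀ b ∈ S, a < b → WellOrderingRel a b := by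
    intro a ha b _ hab
    rcases trichotomous_of (WellOrderingRel (α := α)) a b with h | h | h
    · exact h
    · exact absurd h hab.ne
    · exact absurd (ha b h) hab.not_gt
  have hwf : WellFoundedLT S :=
    ⟨Subrelation.wf (r := InvImage WellOrderingRel (Subtype.val : S → α))
      (fun {a b} h => hlt a a.2 b b.2 h) (InvImage.wf _ IsWellFounded.wf)⟩
  have hgt : ∀ a : α, ∃ b : S, a < b := by
    intro a
    obtain ⟨a', ha'⟩ := exists_gt a
    obtain ⟨b, hb, hab⟩ := hS a'
    exact ⟨⟨b, hb⟩, ha'.trans_le hab⟩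
  have : NoMaxOrder S := ⟨fun a => hgt a⟩
  have : Nonempty S := (hgt (Classical.arbitrary α)).nonempty
  let r : S → S → Prop := (· < ·)
  refine ⟨Ordinal.type r, fun γ => if h : γ < Ordinal.type r then
    (Ordinal.enum r ⟨γ, h⟩ : S) else (Classical.arbitrary α), ?_, ?_, ?_⟩
  · exact Ordinal.isSuccLimit_iff.2
      ⟨Ordinal.type_ne_zero_of_nonempty _, Ordinal.isSuccPrelimit_type_lt⟩
  · intro γ hγ δ hδ h
    simp only [Set.mem_Iio] at hγ hδ
    simp only [hγ, hδ, dif_pos]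
    exact (Ordinal.enum_lt_enum (r := r) (o₁ := ⟨γ, hγ⟩) (o₂ := ⟨δ, hδ⟩)).2 h
  · intro a
    obtain ⟨b, hb⟩ := hgt a
    refine ⟨Ordinal.typein r b, Ordinal.typein_lt_type r b, ?_⟩
    have h : Ordinal.enum r ⟨Ordinal.typein r b, Ordinal.typein_lt_type r b⟩ = b :=
      Ordinal.enum_typein r b
    simp only [Ordinal.typein_lt_type r b, dif_pos]
    rw [h]
    exact hb

/-! ### Linear difference equations -/

namespace AnalyticDifference

/-- Vanishing leading coefficients can be dropped one at a time. This matters because reduction to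
the residue field may kill the leading coefficient. -/
theorem LinearlyClosed.exists_solution {k : Type v} [Field k] {s : k ≃+* k}
    (hk : LinearlyClosed k s) (b : k) :
    ∀ (n : ℕ) (a : Fin (n + 1) → k), a ≠ 0 →
      ∃ x : k, ∑ i : Fin (n + 1), a i * s^[(i : ℕ)] x = b
  | n, a, ha => by
    by_cases hlast : a (Fin.last n) = 0
    · cases n with
      | zero =>
        refine absurd (funext fun i => ?_) ha
        rw [Fin.eq_zero i]
        exact hlast
      | succ n =>
        have ha' : (fun i : Fin (n + 1) => a i.castSucc) ≠ 0 := by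
          intro h
          refine ha (funext fun i => ?_)
          induction i using Fin.lastCases with
          | last => exact hlast
          | cast i => exact congrFun h i
        obtain ⟨x, hx⟩ := hk.exists_solution b n _ ha'
        refine ⟨x, ?_⟩
        rw [Fin.sum_univ_castSucc, hlast, zero_mul, add_zero]
        exact hx
    · exact hk n a b hlast

/-! ### Valuations of monomials in the automorphism -/

namespace AnalyticDifferenceField

variable {A : Type u} [CommRing A] {I : Ideal A} {τ : SystemAut I} {K : Type v} [Field K]

theorem val_mul_le (M : AnalyticDifferenceField I τ K) (d : K) {x y : K}
    (h : M.val x ≤ M.val y) : M.val (d * x) ≤ M.val (d * y) := by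
  rw [AddValuation.map_mul, AddValuation.map_mul]
  exact add_le_add_right h _

theorem val_iterate_le (M : AnalyticDifferenceField I τ K) {x y : K} (h : M.val x ≤ M.val y) :
    ∀ i : ℕ, M.val (M.sigma^[i] x) ≤ M.val (M.sigma^[i] y)
  | 0 => h
  | i + 1 => by
    rw [Function.iterate_succ_apply', Function.iterate_succ_apply']
    exact M.val_sigma_le (M.val_iterate_le h i)

theorem val_symm_le (M : AnalyticDifferenceField I τ K) {x y : K} (h : M.val x ≤ M.val y) :
    M.val (M.sigma.symm x) ≤ M.val (M.sigma.symm y) := by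
  obtain ⟨a, ha⟩ := (M.val_le_val_iff x y).1 h
  refine (M.val_le_val_iff _ _).2 ⟨M.sigmaValRing.symm a, ?_⟩
  rw [← ha, map_mul]
  rfl

theorem val_symm_iterate_le (M : AnalyticDifferenceField I τ K) {x y : K}
    (h : M.val x ≤ M.val y) :
    ∀ i : ℕ, M.val (M.sigma.symm^[i] x) ≤ M.val (M.sigma.symm^[i] y)
  | 0 => h
  | i + 1 => by
    rw [Function.iterate_succ_apply', Function.iterate_succ_apply']
    exact M.val_symm_le (M.val_symm_iterate_le h i)

theorem sigmaVal_iterate_val (M : AnalyticDifferenceField I τ K) (x : K) :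
    ∀ i : ℕ, M.sigmaVal^[i] (M.val x) = M.val (M.sigma^[i] x)
  | 0 => rfl
  | i + 1 => by
    rw [Function.iterate_succ_apply', Function.iterate_succ_apply',
      M.sigmaVal_iterate_val x i, sigmaVal_val]

theorem symm_iterate_iterate (M : AnalyticDifferenceField I τ K) (i : ℕ) (x : K) :
    M.sigma.symm^[i] (M.sigma^[i] x) = x :=
  (Function.LeftInverse.iterate M.sigma.symm_apply_apply i) x

theorem iterate_symm_iterate (M : AnalyticDifferenceField I τ K) (i : ℕ) (x : K) :
    M.sigma^[i] (M.sigma.symm^[i] x) = x :=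
  (Function.LeftInverse.iterate M.sigma.apply_symm_apply i) x

/-- The value at `z` of the `i`-th monomial of the linear difference operator
`∑ i, d i * σ ^ i`. -/
noncomputable def monomialVal (M : AnalyticDifferenceField I τ K) {n : ℕ} (d : Fin (n + 1) → K)
    (i : Fin (n + 1)) (z : K) : M.Val :=
  M.val (d i * M.sigma^[(i : ℕ)] z)

section MonomialVal

variable (M : AnalyticDifferenceField I τ K) {n : ℕ} (d : Fin (n + 1) → K) (i : Fin (n + 1))

theorem monomialVal_mono {x y : K} (h : M.val x ≤ M.val y) :
    M.monomialVal d i x ≤ M.monomialVal d i y :=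
  M.val_mul_le _ (M.val_iterate_le h i)

theorem monomialVal_le_add {x y : K} {g : M.Val} (hx : g ≤ M.monomialVal d i x)
    (hy : g ≤ M.monomialVal d i y) : g ≤ M.monomialVal d i (x + y) := by
  unfold monomialVal
  rw [iterate_map_add, mul_add]
  exact AddValuation.map_le_add _ hx hy

theorem monomialVal_zero : M.monomialVal d i 0 = ⊤ := by
  rw [monomialVal, iterate_map_zero, mul_zero, AddValuation.map_zero]

end MonomialVal

/-! ### Improvements of approximate zeros -/

/-- `y` is a better approximate zero of `f` than `x`, and it is as close to `x` as the linear
approximation `∑ i, d i * σ ^ i` of `f` predicts for a zero of `f`. -/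
def Improves (M : AnalyticDifferenceField I τ K) {n : ℕ} (d : Fin (n + 1) → K) (f : K → K)
    (x y : K) : Prop :=
  M.val (f x) < M.val (f y) ∧ ∀ i, M.val (f x) ≤ M.monomialVal d i (y - x)

theorem Improves.trans {M : AnalyticDifferenceField I τ K} {n : ℕ} {d : Fin (n + 1) → K}
    {f : K → K} {x y z : K} (hxy : M.Improves d f x y) (hyz : M.Improves d f y z) :
    M.Improves d f x z := by
  refine ⟨hxy.1.trans hyz.1, fun i => ?_⟩
  rw [← sub_add_sub_cancel z y x]
  exact M.monomialVal_le_add d i (hxy.1.le.trans (hyz.2 i)) (hxy.2 i)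

/-- The first alternative of `LinearApproxAtProl`, for a function of one variable. -/
def StrictLinearApprox (M : AnalyticDifferenceField I τ K) {n : ℕ} (f : K → K)
    (d : Fin (n + 1) → K) (b : Set K) : Prop :=
  ∀ x ∈ b, ∀ y ∈ b, x ≠ y →
    (Finset.univ.inf fun i => M.monomialVal d i (y - x)) <
      M.val (f y - f x - ∑ i, d i * M.sigma^[(i : ℕ)] (y - x))

section StrictLinearApprox

variable {M : AnalyticDifferenceField I τ K} {n : ℕ} {f : K → K} {d : Fin (n + 1) → K}
  {b : Set K}

/-- If all monomials had larger value, then so would the linear part and the error, whence `val (f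
y) = val (f x)`, contrary to improvement. -/
theorem StrictLinearApprox.exists_monomialVal_eq (hf : M.StrictLinearApprox f d b) {x y : K}
    (hx : x ∈ b) (hy : y ∈ b) (h : M.Improves d f x y) :
    ∃ i, M.monomialVal d i (y - x) = M.val (f x) := by
  by_contra! hne
  have hlt : ∀ i, M.val (f x) < M.monomialVal d i (y - x) := fun i =>
    lt_of_le_of_ne (h.2 i) (hne i).symm
  have htop : M.val (f x) < ⊤ := h.1.trans_le le_top
  have hxy : x ≠ y := by
    rintro rfl
    exact h.1.false
  have h1 := hf x hx y hy hxy
  have h2 : M.val (f x) < Finset.univ.inf fun i => M.monomialVal d i (y - x) :=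
    (Finset.lt_inf_iff htop).2 fun i _ => hlt i
  have h3 : M.val (f x) < M.val (∑ i, d i * M.sigma^[(i : ℕ)] (y - x)) :=
    AddValuation.map_lt_sum' _ htop fun i _ => hlt i
  have h4 := AddValuation.map_lt_add _ (h2.trans h1) h3
  rw [sub_add_cancel, AddValuation.map_sub_eq_of_lt_right _ h.1] at h4
  exact h4.false

/-- Some monomial has value exactly `val (f x)` at `y - x`, but at least `val (f y) > val (f x)` at
`z - y`. Since monomials are monotone in the valuation, the second step is strictly smaller than the
first. -/
theorem StrictLinearApprox.val_sub_lt (hf : M.StrictLinearApprox f d b) {x y z : K}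
    (hx : x ∈ b) (hy : y ∈ b) (hxy : M.Improves d f x y) (hyz : M.Improves d f y z) :
    M.val (x - z) < M.val (y - z) := by
  obtain ⟨i, hi⟩ := hf.exists_monomialVal_eq hx hy hxy
  have h : M.val (y - x) < M.val (z - y) := by
    by_contra! hle
    have := M.monomialVal_mono d i hle
    rw [hi] at this
    exact (hxy.1.trans_le (hyz.2 i)).not_ge this
  rw [M.val.map_sub_swap y z, M.val.map_sub_swap x z, ← sub_add_sub_cancel z y x,
    M.val.map_add_eq_of_lt_right h]
  exact h

theorem StrictLinearApprox.le_val (hf : M.StrictLinearApprox f d b) {x y : K}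
    (hx : x ∈ b) (hy : y ∈ b) (h : ∀ i, M.val (f x) ≤ M.monomialVal d i (y - x)) :
    M.val (f x) ≤ M.val (f y) := by
  rcases eq_or_ne x y with rfl | hxy
  · exact le_rfl
  have h1 : M.val (f x) ≤ Finset.univ.inf fun i => M.monomialVal d i (y - x) :=
    Finset.le_inf fun i _ => h i
  have h2 : M.val (f x) ≤ M.val (∑ i, d i * M.sigma^[(i : ℕ)] (y - x)) :=
    AddValuation.map_le_sum _ fun i _ => h i
  have h3 := M.val.map_le_add (M.val.map_le_add (h1.trans (hf x hx y hy hxy).le) h2) le_rfl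
  rwa [sub_add_cancel, sub_add_cancel] at h3

/-- If the residue field is linearly closed, an approximate zero that is not a zero can be
improved. -/
theorem StrictLinearApprox.exists_improves (hf : M.StrictLinearApprox f d b)
    (hres : M.ResidueLinearlyClosed) {x : K} (hx : x ∈ b) (hfx : f x ≠ 0) (hd : d ≠ 0)
    (hb : ∀ y, (∀ i, M.val (f x) ≤ M.monomialVal d i (y - x)) → y ∈ b) :
    ∃ y, M.Improves d f x y := by
  classical
  obtain ⟨i₁, hi₁⟩ : ∃ i, d i ≠ 0 := Function.ne_iff.1 hd
  -- The scale of the correction: for each `i` with `d i ≠ 0` some `ε` satisfies `d i * σ ^ i ε = f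
  -- x`. The one of largest valuation makes every monomial at least as large in value as `f x`, with
  -- equality at `j`.
  obtain ⟨j, hj, hjmax⟩ := Finset.exists_max_image (Finset.univ.filter fun i => d i ≠ 0)
    (fun i => M.val (M.sigma.symm^[(i : ℕ)] (f x / d i))) ⟨i₁, by simpa using hi₁⟩
  have hdj : d j ≠ 0 := by simpa using hj
  set ε : K := M.sigma.symm^[(j : ℕ)] (f x / d j) with hε
  have hεj : d j * M.sigma^[(j : ℕ)] ε = f x := by
    rw [hε, iterate_symm_iterate, mul_div_cancel₀ _ hdj]
  have hεi : ∀ i, M.val (f x) ≤ M.monomialVal d i ε := by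
    intro i
    rcases eq_or_ne (d i) 0 with hi | hi
    · rw [monomialVal, hi, zero_mul, AddValuation.map_zero]
      exact le_top
    · have h := M.monomialVal_mono d i (hjmax i (by simpa using hi))
      rwa [monomialVal, iterate_symm_iterate, mul_div_cancel₀ _ hi] at h
  choose c hc using fun i => (M.val_le_val_iff _ _).1 (hεi i)
  have hcj : c j = 1 := by
    ext
    exact mul_right_cancel₀ hfx (by rw [hc j, hεj, OneMemClass.coe_one, one_mul])
  -- This is `f x + ∑ i, d i * σ ^ i (ε * y) = 0` divided by `f x` and reduced; it is nontrivial
  -- because `c j = 1`.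
  obtain ⟨w, hw⟩ := hres.exists_solution (-1) n (fun i => IsLocalRing.residue M.valRing (c i)) (by
    intro h
    have := congrFun h j
    simp only [hcj, map_one, Pi.zero_apply, one_ne_zero] at this)
  obtain ⟨y, rfl⟩ := IsLocalRing.residue_surjective w
  have hiter : ∀ i : ℕ, (IsLocalRing.ResidueField.mapEquiv M.sigmaValRing)^[i]
      (IsLocalRing.residue M.valRing y) =
        IsLocalRing.residue M.valRing (M.sigmaValRing^[i] y) := by
    intro i
    induction i with
    | zero => rfl
    | succ i ih => rw [Function.iterate_succ_apply', Function.iterate_succ_apply', ih]; rfl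
  have hcoe : ∀ i : ℕ, ((M.sigmaValRing^[i] y : M.valRing) : K) = M.sigma^[i] y := by
    intro i
    induction i with
    | zero => rfl
    | succ i ih => rw [Function.iterate_succ_apply', Function.iterate_succ_apply', ← ih]; rfl
  have hmax : (∑ i, c i * M.sigmaValRing^[(i : ℕ)] y) + 1 ∈
      IsLocalRing.maximalIdeal M.valRing := by
    rw [← IsLocalRing.residue_eq_zero_iff, map_add, map_sum, map_one]
    simp only [map_mul, ← hiter]
    rw [hw, neg_add_cancel]
  have hpos : (0 : M.Val) < M.val ((∑ i, c i * M.sigma^[(i : ℕ)] (y : K)) + 1) := by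
    have h := (M.valRing.valuation_lt_one_iff _).1 hmax
    have h' : (0 : M.Val) < M.val
      (((∑ i, c i * M.sigmaValRing^[(i : ℕ)] y) + 1 : M.valRing) : K) := h
    simpa [hcoe] using h'
  have hsum : ∑ i, d i * M.sigma^[(i : ℕ)] (ε * y) + f x =
      f x * ((∑ i, c i * M.sigma^[(i : ℕ)] (y : K)) + 1) := by
    rw [mul_add, mul_one, Finset.mul_sum]
    congr 1
    refine Finset.sum_congr rfl fun i _ => ?_
    rw [iterate_map_mul, ← mul_assoc, ← hc i]
    ring
  have hlin : M.val (f x) < M.val (∑ i, d i * M.sigma^[(i : ℕ)] (ε * y) + f x) := by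
    rw [hsum]
    by_contra! hle
    have h := M.val_mul_le (f x)⁻¹ hle
    rw [inv_mul_cancel_left₀ hfx, inv_mul_cancel₀ hfx, AddValuation.map_one] at h
    exact h.not_gt hpos
  have hmono : ∀ i, M.val (f x) ≤ M.monomialVal d i (x + ε * y - x) := by
    intro i
    rw [add_sub_cancel_left]
    refine (hεi i).trans (M.monomialVal_mono d i ?_)
    exact (M.val_le_val_iff _ _).2 ⟨y, mul_comm _ _⟩
  refine ⟨x + ε * y, ?_, hmono⟩
  have hne : x ≠ x + ε * y := by
    intro h
    have h0 : ε * (y : K) = 0 := by simpa using h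
    rw [h0] at hlin
    simp [iterate_map_zero] at hlin
  have h1 := hf x hx _ (hb _ hmono) hne
  have h2 : M.val (f x) ≤ Finset.univ.inf fun i => M.monomialVal d i (x + ε * y - x) :=
    Finset.le_inf fun i _ => hmono i
  have h3 := M.val.map_lt_add (h2.trans_lt h1) hlin
  rwa [add_sub_cancel_left, ← add_assoc, sub_add_cancel, sub_add_cancel] at h3

/-- A pseudo-limit of a sequence of successive improvements improves all its members. -/
theorem StrictLinearApprox.improves_of_isPseudoLimit (hf : M.StrictLinearApprox f d b)
    {β : Ordinal.{v}} {x : Ordinal.{v} → K} {p : K} (hβ : Order.IsSuccLimit β)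
    (hx : ∀ α < β, x α ∈ b)
    (himp : ∀ α γ, α < γ → γ < β → M.Improves d f (x α) (x γ))
    (hp : M.IsPseudoLimit (Set.Iio β) x p)
    (hb : ∀ α < β, (∀ i, M.val (f (x α)) ≤ M.monomialVal d i (p - x α)) → p ∈ b) :
    ∀ α < β, M.Improves d f (x α) p := by
  have hsucc : ∀ α < β, Order.succ α < β := fun α hα => hβ.succ_lt hα
  have hclose : ∀ α < β, ∀ i, M.val (f (x α)) ≤ M.monomialVal d i (p - x α) := by
    intro α hα i
    have hlt := hp α hα (Order.succ α) (hsucc α hα) (Order.lt_succ α)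
    have heq : M.val (x (Order.succ α) - x α) = M.val (p - x α) := by
      -- The pseudo-limit is closer to the successor term than to `x α`.
      rw [← sub_add_sub_cancel _ p, AddValuation.map_add_eq_of_lt_right]
      rwa [M.val.map_sub_swap p]
    exact ((himp α _ (Order.lt_succ α) (hsucc α hα)).2 i).trans
      (M.monomialVal_mono d i heq.le)
  intro α hα
  have hpb : p ∈ b := hb α hα (hclose α hα)
  -- `le_val` gives only a weak inequality at `p`; applying it to the successor term makes it strict
  -- for `α`.
  exact ⟨(himp α _ (Order.lt_succ α) (hsucc α hα)).1.trans_le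
    (hf.le_val (hx _ (hsucc α hα)) hpb (hclose _ (hsucc α hα))), hclose α hα⟩

end StrictLinearApprox

/-- Successive improvements have an upper bound if the function is given by a term. -/
theorem exists_improves_of_sequence {M : AnalyticDifferenceField I τ K}
    (hmax : M.SigmaAlgMaxComplete) {n : ℕ} {t : M.KTerm n} {d : Fin (n + 1) → K} {b : Set K}
    (hf : M.StrictLinearApprox (fun y => M.eval t (M.prol n y)) d b)
    {β : Ordinal.{v}} {x : Ordinal.{v} → K} (hβ : Order.IsSuccLimit β)
    (hx : ∀ α < β, x α ∈ b)
    (himp : ∀ α γ, α < γ → γ < β →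
      M.Improves d (fun y => M.eval t (M.prol n y)) (x α) (x γ))
    (hb : ∀ p, ∀ α < β,
      (∀ i, M.val (M.eval t (M.prol n (x α))) ≤ M.monomialVal d i (p - x α)) → p ∈ b) :
    ∃ p, ∀ α < β, M.Improves d (fun y => M.eval t (M.prol n y)) (x α) p := by
  have hmono : ∀ α γ, α < γ → γ < β →
      M.val (M.eval t (M.prol n (x α))) < M.val (M.eval t (M.prol n (x γ))) :=
    fun α γ h hγ => (himp α γ h hγ).1
  have hpos : (0 : Ordinal) < β := hβ.bot_lt
  have hpc : M.PseudoConvergent (Set.Iio β) x := by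
    refine ⟨fun α hα γ hγ h => ?_, fun α hα γ hγ δ hδ hαγ hγδ =>
      hf.val_sub_lt (hx α hα) (hx γ hγ) (himp α γ hαγ hγ) (himp γ δ hγδ hδ)⟩
    by_contra hne
    rcases lt_or_gt_of_ne hne with hlt | hlt
    · exact (hmono _ _ hlt hγ).ne (by rw [h])
    · exact (hmono _ _ hlt hα).ne (by rw [h])
  have hsol : M.SigmaPseudoSolves β x t := by
    -- The valuations of the values of `t` increase strictly from the start, so the whole sequence
    -- serves as final segment.
    refine Or.inr ⟨0, hpos, ⟨fun α hα γ hγ h => ?_, ?_⟩, ?_⟩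
    · by_contra hne
      rcases lt_or_gt_of_ne hne with hlt | hlt
      · exact (hmono _ _ hlt hγ.2).ne (congrArg M.val h)
      · exact (hmono _ _ hlt hα.2).ne (congrArg M.val h).symm
    · intro α _ γ _ δ hδ hαγ hγδ
      have h := hmono γ δ hγδ hδ.2
      have h' := hmono α δ (hαγ.trans hγδ) hδ.2
      simp only [M.val.map_sub_eq_of_lt_left h, M.val.map_sub_eq_of_lt_left h']
      exact hmono α γ hαγ (hγδ.trans hδ.2)
    · intro α _ γ hγ hαγ
      simpa only [sub_zero] using hmono α γ hαγ hγ.2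
  have hnz : ¬ M.TermIsZero t := by
    intro h
    have := hmono 0 _ (Order.lt_succ 0) (hβ.succ_lt hpos)
    rw [h, h] at this
    exact this.false
  obtain ⟨p, hp⟩ := hmax β x hβ hpc ⟨n, t, hnz, hsol⟩
  exact ⟨p, hf.improves_of_isPseudoLimit hβ hx himp hp (hb p)⟩

/-! ### Zorn's lemma through ordinal sequences -/

/-- A transitive relation that is strictly monotone for a function to a linear order has maximal
elements above each point if its increasing sequences of limit length have upper bounds. -/
theorem exists_maximal_of_sequences_bounded {X : Type v} {Γ : Type*} [LinearOrder Γ]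
    (r : X → X → Prop) (φ : X → Γ) (htrans : ∀ {x y z}, r x y → r y z → r x z)
    (hφ : ∀ {x y}, r x y → φ x < φ y) (a : X)
    (h : ∀ (β : Ordinal.{v}) (x : Ordinal.{v} → X), Order.IsSuccLimit β →
      (∀ α < β, x α = a ∨ r a (x α)) → (∀ α γ, α < γ → γ < β → r (x α) (x γ)) →
      ∃ p, ∀ α < β, r (x α) p) :
    ∃ m, (m = a ∨ r a m) ∧ ∀ y, ¬ r m y := by
  let P : PartialOrder X :=
    { le := fun x y => x = y ∨ r x y
      le_refl := fun x => Or.inl rfl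
      le_trans := by
        rintro x y z (rfl | hxy) (rfl | hyz)
        · exact Or.inl rfl
        · exact Or.inr hyz
        · exact Or.inr hxy
        · exact Or.inr (htrans hxy hyz)
      le_antisymm := by
        rintro x y (rfl | hxy) (hyx | hyx)
        · rfl
        · rfl
        · exact hyx.symm
        · exact absurd (hφ hxy) (hφ hyx).not_gt }
  have key : ∀ c ⊆ Set.Ici a, IsChain (· ≤ ·) c → ∀ y ∈ c, ∃ ub, ∀ z ∈ c, z ≤ ub := by
    intro c hca hc y hy
    have hlt : ∀ u v : c, φ u < φ v → r u v := by
      intro u v huv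
      rcases hc.total u.2 v.2 with (h | h) | (h | h)
      · exact absurd (congrArg φ h) huv.ne
      · exact h
      · exact absurd (congrArg φ h) huv.ne'
      · exact absurd (hφ h) huv.not_gt
    have hinj : Function.Injective fun u : c => φ u := by
      intro u v huv
      rcases hc.total u.2 v.2 with (h | h) | (h | h)
      · exact Subtype.ext h
      · exact absurd huv (hφ h).ne
      · exact Subtype.ext h.symm
      · exact absurd huv (hφ h).ne'
    -- On a chain `φ` is injective and reflects the relation, so a chain without a largest value of
    -- `φ` has a cofinal increasing sequence of limit length.
    let L : LinearOrder c := LinearOrder.lift' (fun u : c => φ u) hinj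
    by_cases hmax : ∃ m : c, ∀ u : c, φ u ≤ φ m
    · obtain ⟨m, hm⟩ := hmax
      refine ⟨m, fun z hz => ?_⟩
      rcases (hm ⟨z, hz⟩).lt_or_eq with h | h
      · exact Or.inr (hlt ⟨z, hz⟩ m h)
      · exact Or.inl (congrArg Subtype.val (hinj h))
    · push Not at hmax
      have hnomax : @NoMaxOrder c L.toPartialOrder.toPreorder.toLT :=
        @NoMaxOrder.mk c L.toPartialOrder.toPreorder.toLT fun u => hmax u
      obtain ⟨β, x, hβ, hx, hcof⟩ :=
        @exists_strictMonoOn_cofinal_of_noMaxOrder c L ⟨⟨y, hy⟩⟩ hnomax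
      obtain ⟨p, hp⟩ := h β (fun α => x α) hβ
        (fun α _ => (hca (x α).2).imp Eq.symm id)
        (fun α γ hαγ hγ => hlt _ _ (hx (hαγ.trans hγ) hγ hαγ))
      refine ⟨p, fun z hz => ?_⟩
      obtain ⟨γ, hγ, hzγ⟩ := hcof ⟨z, hz⟩
      exact Or.inr (htrans (hlt _ _ hzγ) (hp γ hγ))
  obtain ⟨m, ham, hm⟩ := zorn_le_nonempty_Ici₀ a key a le_rfl
  refine ⟨m, ham.imp Eq.symm id, fun y hy => ?_⟩
  rcases hm (Or.inr hy : m ≤ y) with h | h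
  · exact (hφ hy).ne' (congrArg φ h)
  · exact (hφ hy).not_gt (hφ h)

/-! ### Zeros from Hensel configurations -/

section HenselConfig

variable {M : AnalyticDifferenceField I τ K} {n : ℕ} {t : M.KTerm n} {a : K}
  {d : Fin (n + 1) → K} {ξ : M.Val}

/-- For `d = 0` the minimum would be `⊤`, which nothing exceeds. This rules out the constant case of
linear approximation. -/
theorem HenselConfig.ne_zero (h : M.HenselConfig t a d ξ) : d ≠ 0 := by
  rintro rfl
  refine h.lt_val.not_ge (le_top.trans (Finset.le_inf fun i _ => ?_))
  rw [Pi.zero_apply, AddValuation.map_zero, top_add]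

theorem HenselConfig.strictLinearApprox (h : M.HenselConfig t a d ξ) :
    M.StrictLinearApprox (fun y => M.eval t (M.prol n y)) d (M.openBall ξ a) := by
  rcases h.approx with happ | h0
  · intro x hx y hy hxy
    simpa only [monomialVal, prol, AddValuation.map_mul] using happ x hx y hy hxy
  · exact absurd h0.1 h.ne_zero

/-- Outside the ball, `val (y - a) ≤ ξ` would bound the value of `t` at `a` by every `val (d i) + σ
^ i ξ`, contradicting `lt_val`. -/
theorem HenselConfig.mem_openBall (h : M.HenselConfig t a d ξ) {y : K}
    (hy : ∀ i, M.val (M.eval t (M.prol n a)) ≤ M.monomialVal d i (y - a)) :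
    y ∈ M.openBall ξ a := by
  by_contra hle
  have hle : M.val (y - a) ≤ ξ := not_lt.1 hle
  obtain ⟨z, rfl⟩ := M.val_surjective ξ
  refine h.lt_val.not_ge (Finset.le_inf fun i _ => ?_)
  rw [sigmaVal_iterate_val, ← AddValuation.map_mul]
  exact (hy i).trans (M.monomialVal_mono d i hle)

theorem HenselConfig.exists_zero (h : M.HenselConfig t a d ξ) (hmax : M.SigmaAlgMaxComplete)
    (hres : M.ResidueLinearlyClosed) :
    ∃ c, M.eval t (M.prol n c) = 0 ∧
      ∀ i, M.val (M.eval t (M.prol n a)) ≤ M.monomialVal d i (c - a) := by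
  set f : K → K := fun y => M.eval t (M.prol n y)
  have hf : M.StrictLinearApprox f d (M.openBall ξ a) := h.strictLinearApprox
  have hclose : ∀ y, (y = a ∨ M.Improves d f a y) →
      (M.val (f a) ≤ M.val (f y) ∧ ∀ i, M.val (f a) ≤ M.monomialVal d i (y - a)) := by
    rintro y (rfl | hy)
    · refine ⟨le_rfl, fun i => ?_⟩
      rw [sub_self, monomialVal_zero]
      exact le_top
    · exact ⟨hy.1.le, hy.2⟩
  have hball : ∀ x, (x = a ∨ M.Improves d f a x) → ∀ y,
      (∀ i, M.val (f x) ≤ M.monomialVal d i (y - x)) → y ∈ M.openBall ξ a := by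
    intro x hx y hy
    refine h.mem_openBall fun i => ?_
    rw [← sub_add_sub_cancel y x a]
    exact M.monomialVal_le_add d i ((hclose x hx).1.trans (hy i)) ((hclose x hx).2 i)
  obtain ⟨m, hm, hmm⟩ := exists_maximal_of_sequences_bounded (M.Improves d f)
    (fun y => M.val (f y)) Improves.trans (fun h => h.1) a (fun β x hβ hx himp =>
      exists_improves_of_sequence hmax hf hβ
        (fun α hα => h.mem_openBall (hclose _ (hx α hα)).2) himp
        (fun p α hα => hball _ (hx α hα) p))
  refine ⟨m, ?_, (hclose m hm).2⟩
  by_contra hne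
  obtain ⟨y, hy⟩ := hf.exists_improves hres (h.mem_openBall (hclose m hm).2) hne h.ne_zero
    (hball m hm)
  exact hmm y hy

end HenselConfig

theorem SigmaAlgMaxComplete.sigmaHenselian {M : AnalyticDifferenceField I τ K}
    (hmax : M.SigmaAlgMaxComplete) (hres : M.ResidueLinearlyClosed) : M.SigmaHenselian := by
  intro n t a d ξ h
  obtain ⟨c, hc, hca⟩ := h.exists_zero hmax hres
  refine ⟨c, hc, fun i hi => ?_⟩
  -- Dividing the bound on the `i`-th monomial by `d i` and undoing `σ ^ i` gives the required
  -- distance.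
  have h1 := M.val_mul_le (d i)⁻¹ (hca i)
  rw [inv_mul_cancel_left₀ hi, mul_comm] at h1
  have h2 := M.val_symm_iterate_le h1 i
  rwa [symm_iterate_iterate] at h2

end AnalyticDifferenceField

end AnalyticDifference

theorem mainTheorem11 {A : Type u} [CommRing A] [IsNoetherianRing A] (I : Ideal A)
    [IsAdicComplete I A] (τ : AnalyticDifference.SystemAut I)
    {K : Type v} [Field K] [CharZero K]
    (M : AnalyticDifference.AnalyticDifferenceField I τ K)
    (hmax : M.SigmaAlgMaxComplete) (hres : M.ResidueLinearlyClosed) :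
    M.SigmaHenselian :=
  hmax.sigmaHenselian hres
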